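/- Let $d\ge 1$, let $\Omega\subset\mathbb{R}^d$ be a bounded Lipschitz domain (open, connected, nonempty), and let $dS$ denote the surface measure ($(d-1)$-dimensional Hausdorff measure) on $\partial\Omega$. Let $r_K,r_R>0$ and let $K,R:[0,\infty)\to[0,\infty)$ be $C^1$, monotonically decreasing, not identically zero, with $\operatorname{supp}K\subset[0,r_K^2/4]$ and $\operatorname{supp}R\subset[0,r_R^2/4]$. Put $\bar R(x)=\int_x^\infty R(s)\,ds$ for $x\ge0$, and for $\delta>0$ and $k\in\{K,R,\bar R\}$ put $$k_\delta(x,y)=\frac{1}{\delta^d}\,k\!\left(\frac{|x-y|^2}{4\delta^2}\right),\qquad x,y\in\mathbb{R}^d.$$ Let $f\in L^2(\Omega)$, $a,b\in L^2(\partial\Omega)$, $\delta>0$ and $\xi>0$, and for $u\in L^2(\Omega)$ define $$F(u)=\int_\Omega\left|\frac1{\delta^2}\int_\Omega R_\delta(x,y)\,(u(x)-u(y))\,dy-2\int_{\partial\Omega}\bar R_\delta(x,y)\,b(y)\,dS(y)\right|^2dx-2\int_\Omega f u\,dx+B(u,a),$$ $$B(u,a)=\frac1\xi\int_{\partial\Omega}\left|\int_\Omega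 K_\delta(x,y)\,(a(x)-u(y))\,dy\right|^2dS(x).$$ Then all these integrals converge absolutely, so that $F:L^2(\Omega)\to\mathbb{R}$ is well defined, and $F$ has a unique minimizer in $L^2(\Omega)$. -/

import Mathlib

open MeasureTheory Set

noncomputable section

namespace NonlocalBiharmonic

/-- `d`-dimensional Euclidean space. -/
abbrev Space (d : ℕ) := EuclideanSpace ℝ (Fin d)

/-- A bounded Lipschitz domain: a nonempty, connected, bounded open set that, near each boundary
point and in suitable orthonormal coordinates (`e` is the last coordinate direction), is the region
on one side of the graph of a Lipschitz function of the remaining coordinates. -/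
structure IsBoundedLipschitzDomain {d : ℕ} (Ω : Set (Space d)) : Prop where
  isOpen : IsOpen Ω
  isConnected : IsConnected Ω
  isBounded : Bornology.IsBounded Ω
  locally_graph : ∀ p ∈ frontier Ω, ∃ (e : Space d) (g : (ℝ ∙ e)ᗮ → ℝ) (L : NNReal) (r : ℝ),
    ‖e‖ = 1 ∧ LipschitzWith L g ∧ 0 < r ∧
      ∀ x ∈ Metric.ball p r,
        (x ∈ Ω ↔ g ((ℝ ∙ e)ᗮ.orthogonalProjectionOnto x) < inner ℝ e x)

/-- The surface measure `dS` on `∂Ω`: the normalized `(d-1)`-dimensional Hausdorff measure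
restricted to the boundary. -/
def surfaceMeasure {d : ℕ} (Ω : Set (Space d)) : Measure (Space d) :=
  (Measure.euclideanHausdorffMeasure (d - 1)).restrict (frontier Ω)

/-- `L²(Ω)`. -/
abbrev L2 {d : ℕ} (Ω : Set (Space d)) := Lp ℝ 2 (volume.restrict Ω)

/-- `L²(∂Ω)`. -/
abbrev L2Boundary {d : ℕ} (Ω : Set (Space d)) := Lp ℝ 2 (surfaceMeasure Ω)

/-- The conditions on a one-dimensional kernel `k : [0,∞) → [0,∞)` with support parameter `ρ`.
Only the values of `k` on `[0,∞)` matter. -/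
structure IsKernel (ρ : ℝ) (k : ℝ → ℝ) : Prop where
  contDiffOn : ContDiffOn ℝ 1 k (Ici 0)
  nonneg : ∀ s, 0 ≤ s → 0 ≤ k s
  antitoneOn : AntitoneOn k (Ici 0)
  support : ∀ s, 0 ≤ s → k s ≠ 0 → s ≤ ρ ^ 2 / 4

/-- The tail integral `x ↦ ∫_x^∞ k(s) ds`. -/
def tail (k : ℝ → ℝ) (x : ℝ) : ℝ := ∫ s in Ioi x, k s

/-- The scaled kernel `k_δ(x,y) = δ^{-d} k(|x-y|² / (4δ²))`. -/
def scaled {d : ℕ} (k : ℝ → ℝ) (δ : ℝ) (x y : Space d) : ℝ :=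
  1 / δ ^ d * k (‖x - y‖ ^ 2 / (4 * δ ^ 2))

/-- The nonlocal Laplacian of `u` with the boundary flux correction, at the point `x`. -/
def interiorTerm {d : ℕ} (Ω : Set (Space d)) (R : ℝ → ℝ) (δ : ℝ) (b : L2Boundary Ω) (u : L2 Ω)
    (x : Space d) : ℝ :=
  1 / δ ^ 2 * (∫ y in Ω, scaled R δ x y * (u x - u y)) -
    2 * ∫ y, scaled (tail R) δ x y * b y ∂(surfaceMeasure Ω)

/-- The inner integral of the boundary penalty, at the boundary point `x`. -/
def boundaryResidual {d : ℕ} (Ω : Set (Space d)) (K : ℝ → ℝ) (δ : ℝ) (a : L2Boundary Ω) (u : L2 Ω)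
    (x : Space d) : ℝ :=
  ∫ y in Ω, scaled K δ x y * (a x - u y)

/-- The boundary penalty term `B(u,a)`. -/
def penalty {d : ℕ} (Ω : Set (Space d)) (K : ℝ → ℝ) (δ ξ : ℝ) (a : L2Boundary Ω) (u : L2 Ω) : ℝ :=
  1 / ξ * ∫ x, |boundaryResidual Ω K δ a u x| ^ 2 ∂(surfaceMeasure Ω)

/-- The nonlocal energy `F(u; a, b, f)`. -/
def energy {d : ℕ} (Ω : Set (Space d)) (K R : ℝ → ℝ) (δ ξ : ℝ) (a b : L2Boundary Ω) (f : L2 Ω)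
    (u : L2 Ω) : ℝ :=
  (∫ x in Ω, |interiorTerm Ω R δ b u x| ^ 2) - 2 * (∫ x in Ω, f x * u x) + penalty Ω K δ ξ a u

/-- All integrals in the definition of `F(u; a, b, f)` converge absolutely, so that `energy`
is the genuine (finite) value of the functional at `u`. -/
structure EnergyWellDefined {d : ℕ} (Ω : Set (Space d)) (K R : ℝ → ℝ) (δ : ℝ)
    (a b : L2Boundary Ω) (f : L2 Ω) (u : L2 Ω) : Prop where
  tail_integrable : ∀ x, 0 ≤ x → IntegrableOn R (Ioi x)
  laplacian_integrable : ∀ᵐ x ∂(volume.restrict Ω),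
    IntegrableOn (fun y => scaled R δ x y * (u x - u y)) Ω
  flux_integrable : ∀ᵐ x ∂(volume.restrict Ω),
    Integrable (fun y => scaled (tail R) δ x y * b y) (surfaceMeasure Ω)
  interior_integrable : IntegrableOn (fun x => |interiorTerm Ω R δ b u x| ^ 2) Ω
  source_integrable : IntegrableOn (fun x => f x * u x) Ω
  residual_integrable : ∀ᵐ x ∂(surfaceMeasure Ω),
    IntegrableOn (fun y => scaled K δ x y * (a x - u y)) Ω
  penalty_integrable : Integrable (fun x => |boundaryResidual Ω K δ a u x| ^ 2) (surfaceMeasure Ω)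

end NonlocalBiharmonic

end

/-! The energy is a least squares functional `‖A u - β‖² - 2⟪f, u⟫ + ‖C u - α‖²` on `L²(Ω)`. Here
`A` is the nonlocal Laplacian, `C` is `1/√ξ` times the integral operator of `K_δ` from `Ω` to `∂Ω`,
and `β`, `α` come from `b`, `a`. The kernels are bounded and both measures are finite, so all these
operators are bounded on `L²`; this also gives absolute convergence.

Existence and uniqueness follow from `κ‖u‖² ≤ ‖A u‖² + ‖C u‖²`, which makes the normal operator `A*A
+ C*C` invertible (`existsUnique_forall_le_of_coercive`).

For the bound, split `u` into a constant and a part of mean zero. `A` kills constants, and `⟪A v,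
v⟫` is a multiple of the Dirichlet form of `R_δ`. That form is coercive on mean zero functions by a
nonlocal Poincaré inequality (`exists_lintegral_sub_sq_le`), because `R_δ` is bounded below near the
diagonal and `Ω` is connected. The constant is seen by `C`, since `∫_Ω K_δ(x,y) dy > 0` at every
boundary point and `∂Ω` has positive measure.

The Lipschitz graphs serve only to show that `∂Ω` has finite, positive surface measure. -/

namespace NonlocalBiharmonic

/-! ### Surface measure of a Lipschitz boundary -/

open Filter Topology in
/-- Inside a graph chart, the boundary of the domain is exactly the graph. -/
theorem mem_frontier_iff_of_graph {d : ℕ} {Ω : Set (Space d)} (hΩ : IsOpen Ω) {e p : Space d}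
    {g : (ℝ ∙ e)ᗮ → ℝ} {r : ℝ} (he : ‖e‖ = 1) (hg : Continuous g)
    (h : ∀ x ∈ Metric.ball p r,
      (x ∈ Ω ↔ g ((ℝ ∙ e)ᗮ.orthogonalProjectionOnto x) < inner ℝ e x))
    {x : Space d} (hx : x ∈ Metric.ball p r) :
    x ∈ frontier Ω ↔ g ((ℝ ∙ e)ᗮ.orthogonalProjectionOnto x) = inner ℝ e x := by
  rw [hΩ.frontier_eq, Set.mem_sdiff, h x hx, not_lt]
  constructor
  · rintro ⟨hc, hle⟩
    refine le_antisymm ?_ hle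
    have hmem := Metric.isOpen_ball.inter_closure ⟨hx, hc⟩
    have hcl : IsClosed {y : Space d |
        g ((ℝ ∙ e)ᗮ.orthogonalProjectionOnto y) ≤ inner ℝ e y} :=
      isClosed_le (by fun_prop) (by fun_prop)
    exact closure_minimal (fun y hy => ((h y hy.1).1 hy.2).le) hcl hmem
  · intro heq
    refine ⟨?_, heq.ge⟩
    -- Moving a point of the graph along `e` leaves its projection fixed and raises its height, so
    -- it enters `Ω`.
    have ht : Tendsto (fun t : ℝ => x + t • e) (𝓝[>] 0) (𝓝 x) := by
      have : Tendsto (fun t : ℝ => x + t • e) (𝓝 0) (𝓝 (x + (0 : ℝ) • e)) :=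
        Continuous.tendsto (by fun_prop) 0
      simpa using this.mono_left nhdsWithin_le_nhds
    refine mem_closure_of_tendsto ht ?_
    filter_upwards [ht (Metric.isOpen_ball.mem_nhds hx), self_mem_nhdsWithin] with t htb ht0
    rw [h _ htb, map_add, map_smul,
      Submodule.orthogonalProjectionOnto_orthogonalComplement_singleton_eq_zero, smul_zero,
      add_zero, heq, inner_add_right, inner_smul_right, real_inner_self_eq_norm_sq, he]
    have : (0 : ℝ) < t := ht0
    linarith

theorem orthogonalProjectionOnto_add_inner_smul {d : ℕ} {e : Space d} (he : ‖e‖ = 1)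
    (x : Space d) :
    ((ℝ ∙ e)ᗮ.orthogonalProjectionOnto x : Space d) + inner ℝ e x • e = x := by
  have h := (ℝ ∙ e).starProjection_add_starProjection_orthogonal x
  rw [Submodule.starProjection_unit_singleton ℝ he] at h
  rw [add_comm]
  exact h

theorem finrank_orthogonal_singleton {d : ℕ} {e : Space d} (he : ‖e‖ = 1) :
    Module.finrank ℝ ((ℝ ∙ e)ᗮ : Submodule ℝ (Space d)) = d - 1 := by
  have h0 : e ≠ 0 := by
    rintro rfl
    simp at he
  have h1 := finrank_span_singleton (K := ℝ) h0
  have h2 := (ℝ ∙ e).finrank_add_finrank_orthogonal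
  rw [h1, finrank_euclideanSpace_fin] at h2
  omega

/-- The hyperplane has dimension `d - 1`, so this Hausdorff measure is finite on its balls and
positive on its nonempty open sets. -/
theorem isAddHaarMeasure_hausdorffMeasure_orthogonal_singleton {d : ℕ} {e : Space d}
    (he : ‖e‖ = 1) :
    (Measure.hausdorffMeasure ((d - 1 : ℕ) : ℝ) :
      Measure ((ℝ ∙ e)ᗮ : Submodule ℝ (Space d))).IsAddHaarMeasure := by
  rw [← finrank_orthogonal_singleton he]
  infer_instance

/-- The boundary of a bounded Lipschitz domain has finite surface measure. -/
theorem IsBoundedLipschitzDomain.isFiniteMeasure_surfaceMeasure {d : ℕ} {Ω : Set (Space d)}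
    (hΩ : IsBoundedLipschitzDomain Ω) : IsFiniteMeasure (surfaceMeasure Ω) := by
  refine ⟨?_⟩
  rw [surfaceMeasure, Measure.restrict_apply_univ]
  have hcomp : IsCompact (frontier Ω) :=
    hΩ.isBounded.isCompact_closure.of_isClosed_subset isClosed_frontier frontier_subset_closure
  refine hcomp.measure_lt_top_of_nhdsWithin fun p hp => ?_
  obtain ⟨e, g, L, r, he, hg, hr, h⟩ := hΩ.locally_graph p hp
  refine ⟨frontier Ω ∩ Metric.ball p r,
    inter_mem_nhdsWithin _ (Metric.ball_mem_nhds p hr), ?_⟩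
  have hlip : LipschitzWith (1 + L) fun z : (ℝ ∙ e)ᗮ => (z : Space d) + g z • e := by
    refine LipschitzWith.of_dist_le_mul fun z w => ?_
    rw [dist_eq_norm]
    calc ‖(z : Space d) + g z • e - (w + g w • e)‖
        = ‖((z : Space d) - w) + (g z - g w) • e‖ := by congr 1; module
      _ ≤ ‖(z : Space d) - w‖ + ‖(g z - g w) • e‖ := norm_add_le _ _
      _ = dist z w + dist (g z) (g w) := by
          rw [norm_smul, he, mul_one, dist_eq_norm, dist_eq_norm]; rfl
      _ ≤ dist z w + L * dist z w := by gcongr; exact hg.dist_le_mul z w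
      _ = _ := by push_cast; ring
  have hsub : frontier Ω ∩ Metric.ball p r ⊆ (fun z : (ℝ ∙ e)ᗮ => (z : Space d) + g z • e) ''
      Metric.ball ((ℝ ∙ e)ᗮ.orthogonalProjectionOnto p) r := by
    rintro x ⟨hxf, hxb⟩
    refine ⟨(ℝ ∙ e)ᗮ.orthogonalProjectionOnto x, ?_, ?_⟩
    · rw [Metric.mem_ball] at hxb ⊢
      refine lt_of_le_of_lt ?_ hxb
      simpa using (Submodule.lipschitzWith_orthogonalProjectionOnto (ℝ ∙ e)ᗮ).dist_le_mul x p
    · simp only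
      rw [(mem_frontier_iff_of_graph hΩ.isOpen he hg.continuous h hxb).1 hxf]
      exact orthogonalProjectionOnto_add_inner_smul he x
  refine (measure_mono hsub).trans_lt ?_
  rw [Measure.euclideanHausdorffMeasure_def, Measure.smul_apply]
  have := isAddHaarMeasure_hausdorffMeasure_orthogonal_singleton he
  have hlt := (hlip.hausdorffMeasure_image_le (d := ((d - 1 : ℕ) : ℝ)) (by positivity)
    (Metric.ball ((ℝ ∙ e)ᗮ.orthogonalProjectionOnto p) r)).trans_lt
    (ENNReal.mul_lt_top (ENNReal.rpow_lt_top_of_nonneg (by positivity) ENNReal.coe_ne_top)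
      Metric.isBounded_ball.measure_lt_top)
  exact ENNReal.mul_lt_top ENNReal.coe_lt_top hlt

/-- The boundary of a bounded Lipschitz domain has positive surface measure. -/
theorem IsBoundedLipschitzDomain.surfaceMeasure_ne_zero {d : ℕ} (hd : 1 ≤ d) {Ω : Set (Space d)}
    (hΩ : IsBoundedLipschitzDomain Ω) : surfaceMeasure Ω ≠ 0 := by
  have : NeZero d := ⟨by omega⟩
  have hne : (frontier Ω).Nonempty := by
    rw [nonempty_frontier_iff]
    refine ⟨hΩ.isConnected.nonempty, fun hu => ?_⟩
    exact NormedSpace.unbounded_univ ℝ (Space d) (hu ▸ hΩ.isBounded)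
  obtain ⟨p, hp⟩ := hne
  obtain ⟨e, g, L, r, he, hg, hr, h⟩ := hΩ.locally_graph p hp
  set P := (ℝ ∙ e)ᗮ.orthogonalProjectionOnto with hP
  have hpg : (P p : Space d) + g (P p) • e = p := by
    rw [(mem_frontier_iff_of_graph hΩ.isOpen he hg.continuous h (Metric.mem_ball_self hr)).1 hp]
    exact orthogonalProjectionOnto_add_inner_smul he p
  have hcont : Continuous fun z : (ℝ ∙ e)ᗮ => (z : Space d) + g z • e := by
    have := hg.continuous
    fun_prop
  have hopen : IsOpen ((fun z : (ℝ ∙ e)ᗮ => (z : Space d) + g z • e) ⁻¹' Metric.ball p r) :=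
    Metric.isOpen_ball.preimage hcont
  -- The projection of the boundary contains an open set of the hyperplane. As the projection is
  -- 1-Lipschitz, a null boundary would make that set null.
  have hsub : (fun z : (ℝ ∙ e)ᗮ => (z : Space d) + g z • e) ⁻¹' Metric.ball p r ⊆
      P '' frontier Ω := by
    intro z hz
    have hPz : P ((z : Space d) + g z • e) = z := by
      rw [map_add, map_smul, hP,
        Submodule.orthogonalProjectionOnto_orthogonalComplement_singleton_eq_zero, smul_zero,
        add_zero, Submodule.orthogonalProjectionOnto_mem_subspace_eq_self]
    refine ⟨_, (mem_frontier_iff_of_graph hΩ.isOpen he hg.continuous h hz).2 ?_, hPz⟩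
    rw [← hP, hPz, inner_add_right, inner_smul_right, real_inner_self_eq_norm_sq, he,
      Submodule.mem_orthogonal_singleton_iff_inner_right.1 z.2]
    ring
  have := isAddHaarMeasure_hausdorffMeasure_orthogonal_singleton he
  have hpos : 0 < Measure.hausdorffMeasure ((d - 1 : ℕ) : ℝ) (P '' frontier Ω) :=
    (hopen.measure_pos _ ⟨P p, by
      rw [mem_preimage, hpg]; exact Metric.mem_ball_self hr⟩).trans_le (measure_mono hsub)
  intro hzero
  have hz : surfaceMeasure Ω univ = 0 := by simp [hzero]
  rw [surfaceMeasure, Measure.restrict_apply_univ, Measure.euclideanHausdorffMeasure_def,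
    Measure.smul_apply] at hz
  have hf := Measure.addHaarScalarFactor_volume_hausdorffMeasure_ne_zero (d - 1)
  have hz' : Measure.hausdorffMeasure ((d - 1 : ℕ) : ℝ) (frontier Ω) = 0 := by
    rcases mul_eq_zero.1 hz with h1 | h1
    · exact absurd (ENNReal.coe_eq_zero.1 h1) hf
    · exact h1
  refine hpos.ne' (le_antisymm ?_ zero_le)
  refine (((ℝ ∙ e)ᗮ.lipschitzWith_orthogonalProjectionOnto).hausdorffMeasure_image_le
    (by positivity) _).trans ?_
  rw [hz', mul_zero]

/-! ### Coercive least squares in Hilbert space -/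

section Hilbert

variable {H G : Type*} [NormedAddCommGroup H] [InnerProductSpace ℝ H]
  [NormedAddCommGroup G] [InnerProductSpace ℝ G]

/-- If `A` is coercive on the orthogonal complement of `e`, kills `e`, and `C` does not kill `e`,
then the pair `(A, C)` controls the norm. -/
theorem exists_sq_norm_le_of_coercive_orthogonal (A : H →L[ℝ] H) (C : H →L[ℝ] G) {e : H} {c : ℝ}
    (hc : 0 < c) (hAe : A e = 0) (hCe : C e ≠ 0)
    (hA : ∀ v, inner ℝ e v = 0 → c * ‖v‖ ^ 2 ≤ inner ℝ (A v) v) :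
    ∃ κ, 0 < κ ∧ ∀ u, κ * ‖u‖ ^ 2 ≤ ‖A u‖ ^ 2 + ‖C u‖ ^ 2 := by
  have he : e ≠ 0 := by
    rintro rfl
    simp at hCe
  have hCe' : 0 < ‖C e‖ := norm_pos_iff.2 hCe
  have he' : 0 < ‖e‖ := norm_pos_iff.2 he
  set q := ‖e‖ / ‖C e‖ with hq
  have hq0 : 0 < q := by positivity
  set p := c⁻¹ * (1 + q * ‖C‖) with hp
  have hp0 : 0 < p := by positivity
  have key : ∀ u, ‖u‖ ≤ p * ‖A u‖ + q * ‖C u‖ := by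
    intro u
    -- `t • e` is the component of `u` along `e`. Coercivity bounds the remainder `v` by `A u`; then
    -- `t • C e = C u - C v` bounds `t`.
    set t := inner ℝ e u / ‖e‖ ^ 2 with ht
    set v := u - t • e with hv
    have huv : u = v + t • e := by rw [hv]; abel
    have hAv : A v = A u := by rw [hv, map_sub, map_smul, hAe, smul_zero, sub_zero]
    have hev : inner ℝ e v = 0 := by
      rw [hv, inner_sub_right, inner_smul_right, real_inner_self_eq_norm_sq, ht]
      field_simp
      ring
    have h1 : ‖v‖ ≤ c⁻¹ * ‖A u‖ := by
      have h2 := (hA v hev).trans (real_inner_le_norm _ _)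
      rw [hAv] at h2
      rcases eq_or_lt_of_le (norm_nonneg v) with h0 | h0
      · rw [← h0]; positivity
      · rw [inv_mul_eq_div, le_div_iff₀ hc]
        nlinarith
    have h3 : |t| * ‖C e‖ ≤ ‖C u‖ + ‖C‖ * (c⁻¹ * ‖A u‖) := by
      calc |t| * ‖C e‖ = ‖C u - C v‖ := by
            rw [← map_sub, hv, sub_sub_cancel, map_smul, norm_smul, Real.norm_eq_abs]
        _ ≤ ‖C u‖ + ‖C v‖ := norm_sub_le _ _
        _ ≤ ‖C u‖ + ‖C‖ * (c⁻¹ * ‖A u‖) := by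
            gcongr
            exact (C.le_opNorm v).trans (by gcongr)
    have h4 : |t| * ‖e‖ ≤ q * (‖C u‖ + ‖C‖ * (c⁻¹ * ‖A u‖)) := by
      calc |t| * ‖e‖ = q * (|t| * ‖C e‖) := by rw [hq]; field_simp
        _ ≤ _ := by gcongr
    calc ‖u‖ ≤ ‖v‖ + ‖t • e‖ := by conv_lhs => rw [huv]
                                   exact norm_add_le _ _
      _ ≤ c⁻¹ * ‖A u‖ + q * (‖C u‖ + ‖C‖ * (c⁻¹ * ‖A u‖)) := by
          rw [norm_smul, Real.norm_eq_abs]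
          gcongr
      _ = p * ‖A u‖ + q * ‖C u‖ := by rw [hp]; ring
  refine ⟨(p ^ 2 + q ^ 2)⁻¹, by positivity, fun u => ?_⟩
  rw [inv_mul_le_iff₀ (by positivity)]
  calc ‖u‖ ^ 2 ≤ (p * ‖A u‖ + q * ‖C u‖) ^ 2 := by gcongr; exact key u
    _ ≤ _ := by nlinarith [sq_nonneg (p * ‖C u‖ - q * ‖A u‖)]

variable [CompleteSpace H] [CompleteSpace G]

/-- A coercive least squares functional with a linear term has a unique minimizer. -/
theorem existsUnique_forall_le_of_coercive (A : H →L[ℝ] H) (C : H →L[ℝ] G) {κ : ℝ} (hκ : 0 < κ)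
    (h : ∀ u, κ * ‖u‖ ^ 2 ≤ ‖A u‖ ^ 2 + ‖C u‖ ^ 2) (β f : H) (α : G) (J : H → ℝ)
    (hJ : ∀ u, J u = ‖A u - β‖ ^ 2 - 2 * inner ℝ f u + ‖C u - α‖ ^ 2) :
    ∃! u, ∀ v, J u ≤ J v := by
  -- The normal operator: `S u₀ = A*β + C*α + f` is the Euler–Lagrange equation of `J`.
  set S : H →L[ℝ] H := A.adjoint ∘L A + C.adjoint ∘L C with hS
  have hSi : ∀ u v, inner ℝ (S u) v = inner ℝ (A u) (A v) + inner ℝ (C u) (C v) := by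
    intro u v
    simp [hS, inner_add_left, ContinuousLinearMap.adjoint_inner_left]
  have hunit : IsUnit S := by
    refine ContinuousLinearMap.isUnit_of_forall_le_norm_inner_map S (c := ⟨κ, hκ.le⟩) hκ
      fun u => ?_
    rw [hSi, real_inner_self_eq_norm_sq, real_inner_self_eq_norm_sq, Real.norm_eq_abs]
    refine le_trans ?_ (le_abs_self _)
    exact (mul_comm _ _).trans_le (h u)
  obtain ⟨S', hS'⟩ := hunit.exists_right_inv
  set u₀ := S' (A.adjoint β + C.adjoint α + f) with hu₀
  have hSu : S u₀ = A.adjoint β + C.adjoint α + f := by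
    rw [hu₀, ← mul_apply_eq_comp, hS', one_apply_eq_self]
  -- At the critical point the first-order terms in `w` cancel, leaving the quadratic form, which is
  -- positive for `w ≠ 0`.
  have hexp : ∀ w, J (u₀ + w) = J u₀ + (‖A w‖ ^ 2 + ‖C w‖ ^ 2) := by
    intro w
    have h1 := hSi u₀ w
    rw [hSu, inner_add_left, inner_add_left, ContinuousLinearMap.adjoint_inner_left,
      ContinuousLinearMap.adjoint_inner_left] at h1
    have h2 : A (u₀ + w) - β = (A u₀ - β) + A w := by rw [map_add]; abel
    have h3 : C (u₀ + w) - α = (C u₀ - α) + C w := by rw [map_add]; abel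
    rw [hJ, hJ, h2, h3, norm_add_sq_real (A u₀ - β), norm_add_sq_real (C u₀ - α), inner_sub_left,
      inner_sub_left, inner_add_right]
    linarith
  refine ⟨u₀, fun v => ?_, fun u hu => ?_⟩
  · have := hexp (v - u₀)
    rw [add_sub_cancel] at this
    rw [this]
    linarith [sq_nonneg ‖A (v - u₀)‖, sq_nonneg ‖C (v - u₀)‖]
  · have h1 := hexp (u - u₀)
    rw [add_sub_cancel] at h1
    have h2 := hu u₀
    have h3 := h (u - u₀)
    have h4 : ‖u - u₀‖ ^ 2 ≤ 0 := by
      by_contra hcon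
      push Not at hcon
      nlinarith
    exact sub_eq_zero.1 (norm_eq_zero.1 (pow_eq_zero_iff two_ne_zero |>.1
      (le_antisymm h4 (sq_nonneg _))))

end Hilbert

/-! ### Multiplication and integral operators on `L²` -/

section KernelOperators

variable {X Y : Type*} [MeasurableSpace X] [MeasurableSpace Y] {μ : Measure X} {ν : Measure Y}

theorem exists_mulOp {w : X → ℝ} (hw : AEStronglyMeasurable w μ) {M : ℝ}
    (hM : ∀ x, |w x| ≤ M) :
    ∃ T : Lp ℝ 2 μ →L[ℝ] Lp ℝ 2 μ, ∀ u, T u =ᵐ[μ] fun x => w x * u x := by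
  have hmem : ∀ u : Lp ℝ 2 μ, MemLp (fun x => w x * u x) 2 μ := fun u =>
    (Lp.memLp u).of_le_mul (hw.mul (Lp.aestronglyMeasurable u)) (c := M) <| ae_of_all _ fun x => by
      rw [norm_mul]
      exact mul_le_mul_of_nonneg_right (hM x) (norm_nonneg _)
  let T : Lp ℝ 2 μ →ₗ[ℝ] Lp ℝ 2 μ :=
    { toFun := fun u => (hmem u).toLp _
      map_add' := fun u v => by
        apply Lp.ext
        filter_upwards [(hmem (u + v)).coeFn_toLp, (hmem u).coeFn_toLp, (hmem v).coeFn_toLp,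
          Lp.coeFn_add u v, Lp.coeFn_add ((hmem u).toLp _) ((hmem v).toLp _)] with x h1 h2 h3 h4 h5
        rw [h1, h5, Pi.add_apply, h2, h3, h4, Pi.add_apply, mul_add]
      map_smul' := fun c u => by
        apply Lp.ext
        filter_upwards [(hmem (c • u)).coeFn_toLp, (hmem u).coeFn_toLp,
          Lp.coeFn_smul c u, Lp.coeFn_smul c ((hmem u).toLp _)] with x h1 h2 h3 h4
        rw [RingHom.id_apply, h1, h4, Pi.smul_apply, h2, h3, Pi.smul_apply, smul_eq_mul,
          smul_eq_mul, mul_left_comm] }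
  refine ⟨T.mkContinuous M fun u => ?_, fun u => (hmem u).coeFn_toLp⟩
  refine Lp.norm_le_mul_norm_of_ae_le_mul ?_
  filter_upwards [(hmem u).coeFn_toLp] with x hx
  rw [show T u x = w x * u x from hx, norm_mul]
  exact mul_le_mul_of_nonneg_right (hM x) (norm_nonneg _)

theorem Lp_two_integrable [IsFiniteMeasure ν] (u : Lp ℝ 2 ν) : Integrable u ν :=
  (Lp.memLp u).integrable one_le_two

theorem integral_norm_le_norm_Lp_two [IsFiniteMeasure ν] (u : Lp ℝ 2 ν) :
    ∫ y, ‖u y‖ ∂ν ≤ √(ν.real univ) * ‖u‖ := by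
  have hle := eLpNorm_le_eLpNorm_mul_rpow_measure_univ (one_le_two (α := ENNReal))
    (Lp.aestronglyMeasurable u)
  have hfin : eLpNorm u 2 ν * ν univ ^ (1 / (1 : ENNReal).toReal - 1 / (2 : ENNReal).toReal) ≠ ⊤ :=
    ENNReal.mul_ne_top (Lp.eLpNorm_ne_top u)
      (ENNReal.rpow_ne_top_of_nonneg (by norm_num) (measure_ne_top ν _))
  have h := ENNReal.toReal_mono hfin hle
  rw [eLpNorm_one_eq_lintegral_enorm, ← integral_norm_eq_lintegral_enorm
    (Lp.aestronglyMeasurable u), ENNReal.toReal_mul, ← ENNReal.toReal_rpow, ← Lp.norm_def] at h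
  refine h.trans_eq ?_
  rw [mul_comm, Real.sqrt_eq_rpow, Measure.real]
  norm_num

/-- A measurable function of two variables, bounded in absolute value by `M`. -/
structure IsBoundedKernel (k : X → Y → ℝ) (M : ℝ) : Prop where
  measurable : Measurable (Function.uncurry k)
  bound : ∀ x y, |k x y| ≤ M

namespace IsBoundedKernel

variable {k : X → Y → ℝ} {M : ℝ}

theorem measurable_right (hk : IsBoundedKernel k M) (x : X) : Measurable (k x) :=
  hk.measurable.comp (measurable_const.prodMk measurable_id)

theorem integrable_mul (hk : IsBoundedKernel k M) {u : Y → ℝ} (hu : Integrable u ν) (x : X) :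
    Integrable (fun y => k x y * u y) ν :=
  hu.bdd_mul (hk.measurable_right x).aestronglyMeasurable (ae_of_all _ (hk.bound x))

theorem integrable (hk : IsBoundedKernel k M) [IsFiniteMeasure ν] (x : X) : Integrable (k x) ν :=
  (integrable_const M).mono' (hk.measurable_right x).aestronglyMeasurable
    (ae_of_all _ (hk.bound x))

theorem stronglyMeasurable_integral_mul (hk : IsBoundedKernel k M) [SFinite ν] {u : Y → ℝ} (hu : StronglyMeasurable u) :
    StronglyMeasurable fun x => ∫ y, k x y * u y ∂ν :=
  StronglyMeasurable.integral_prod_right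
    (hk.measurable.mul (hu.measurable.comp measurable_snd)).stronglyMeasurable

theorem stronglyMeasurable_integral (hk : IsBoundedKernel k M) [SFinite ν] :
    StronglyMeasurable fun x => ∫ y, k x y ∂ν :=
  StronglyMeasurable.integral_prod_right hk.measurable.stronglyMeasurable

theorem abs_integral_mul_le (hk : IsBoundedKernel k M) {u : Y → ℝ} (hu : Integrable u ν) (x : X) :
    |∫ y, k x y * u y ∂ν| ≤ M * ∫ y, ‖u y‖ ∂ν := by
  rw [← integral_const_mul]
  rw [← Real.norm_eq_abs]
  refine norm_integral_le_of_norm_le (hu.norm.const_mul M) (ae_of_all _ fun y => ?_)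
  rw [norm_mul]
  exact mul_le_mul_of_nonneg_right (hk.bound x y) (norm_nonneg _)

theorem abs_integral_le (hk : IsBoundedKernel k M) [IsFiniteMeasure ν] (x : X) : |∫ y, k x y ∂ν| ≤ M * ν.real univ := by
  have h := hk.abs_integral_mul_le (ν := ν) (integrable_const (1 : ℝ)) x
  simpa using h

/-- Bounded kernels define bounded integral operators between `L²` spaces of finite measures. -/
theorem exists_integralOp (hk : IsBoundedKernel k M) [IsFiniteMeasure μ] [IsFiniteMeasure ν]
    [Nonempty X] [Nonempty Y] :
    ∃ T : Lp ℝ 2 ν →L[ℝ] Lp ℝ 2 μ, ∀ u, T u =ᵐ[μ] fun x => ∫ y, k x y * u y ∂ν := by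
  have hM0 : 0 ≤ M := (abs_nonneg _).trans (hk.bound (Classical.arbitrary X) (Classical.arbitrary Y))
  have hb : ∀ (u : Lp ℝ 2 ν) x, ‖∫ y, k x y * u y ∂ν‖ ≤ M * (√(ν.real univ) * ‖u‖) := fun u x =>
    (hk.abs_integral_mul_le (Lp_two_integrable u) x).trans
      (mul_le_mul_of_nonneg_left (integral_norm_le_norm_Lp_two u) hM0)
  have hmem : ∀ u : Lp ℝ 2 ν, MemLp (fun x => ∫ y, k x y * u y ∂ν) 2 μ := fun u =>
    MemLp.of_bound (hk.stronglyMeasurable_integral_mul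
      (Lp.stronglyMeasurable u)).aestronglyMeasurable _ (ae_of_all _ (hb u))
  let T : Lp ℝ 2 ν →ₗ[ℝ] Lp ℝ 2 μ :=
    { toFun := fun u => (hmem u).toLp _
      map_add' := fun u v => by
        apply Lp.ext
        filter_upwards [(hmem (u + v)).coeFn_toLp, (hmem u).coeFn_toLp, (hmem v).coeFn_toLp,
          Lp.coeFn_add ((hmem u).toLp _) ((hmem v).toLp _)] with x h1 h2 h3 h5
        rw [h1, h5, Pi.add_apply, h2, h3, ← integral_add
          (hk.integrable_mul (Lp_two_integrable u) x) (hk.integrable_mul (Lp_two_integrable v) x)]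
        refine integral_congr_ae ?_
        filter_upwards [Lp.coeFn_add u v] with y hy
        rw [hy, Pi.add_apply, mul_add]
      map_smul' := fun c u => by
        apply Lp.ext
        filter_upwards [(hmem (c • u)).coeFn_toLp, (hmem u).coeFn_toLp,
          Lp.coeFn_smul c ((hmem u).toLp _)] with x h1 h2 h4
        rw [RingHom.id_apply, h1, h4, Pi.smul_apply, h2, smul_eq_mul, ← integral_const_mul]
        refine integral_congr_ae ?_
        filter_upwards [Lp.coeFn_smul c u] with y hy
        rw [hy, Pi.smul_apply, smul_eq_mul, mul_left_comm] }
  refine ⟨T.mkContinuous (measureUnivNNReal μ ^ (2 : ENNReal).toReal⁻¹ * (M * √(ν.real univ)))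
    fun u => ?_, fun u => (hmem u).coeFn_toLp⟩
  have hae : ∀ᵐ x ∂μ, ‖T u x‖ ≤ M * (√(ν.real univ) * ‖u‖) := by
    filter_upwards [(hmem u).coeFn_toLp] with x hx
    rw [show T u x = _ from hx]
    exact hb u x
  refine (Lp.norm_le_of_ae_bound (by positivity) hae).trans_eq ?_
  ring

theorem integral_mul_sub (hk : IsBoundedKernel k M) [IsFiniteMeasure ν] {u : Y → ℝ} (hu : Integrable u ν) (c : ℝ) (x : X) :
    Integrable (fun y => k x y * (c - u y)) ν ∧
      ∫ y, k x y * (c - u y) ∂ν = (∫ y, k x y ∂ν) * c - ∫ y, k x y * u y ∂ν := by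
  have h1 := (hk.integrable (ν := ν) x).mul_const c
  have h2 := hk.integrable_mul hu x
  simp_rw [mul_sub]
  exact ⟨h1.sub h2, by rw [integral_sub h1 h2, integral_mul_const]⟩

end IsBoundedKernel

/-- The Dirichlet form of a symmetric bounded kernel, expanded. -/
theorem IsBoundedKernel.integral_prod_mul_sub_sq [IsFiniteMeasure μ] {k : X → X → ℝ} {M : ℝ}
    (hk : IsBoundedKernel k M) (hsymm : ∀ x y, k x y = k y x) {v : X → ℝ} (hv : MemLp v 2 μ) :
    Integrable (fun p : X × X => k p.1 p.2 * (v p.1 - v p.2) ^ 2) (μ.prod μ) ∧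
      ∫ p : X × X, k p.1 p.2 * (v p.1 - v p.2) ^ 2 ∂(μ.prod μ) =
        2 * ∫ x, ((∫ y, k x y ∂μ) * v x - ∫ y, k x y * v y ∂μ) * v x ∂μ := by
  have hvi := hv.integrable one_le_two
  have hv2 := hv.integrable_sq
  have hkm : AEStronglyMeasurable (fun p : X × X => k p.1 p.2) (μ.prod μ) :=
    hk.measurable.aestronglyMeasurable
  have hkb : ∀ᵐ p : X × X ∂(μ.prod μ), ‖k p.1 p.2‖ ≤ M := ae_of_all _ fun p => hk.bound _ _
  have i1 : Integrable (fun p : X × X => k p.1 p.2 * v p.1 ^ 2) (μ.prod μ) :=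
    (hv2.comp_fst μ).bdd_mul hkm hkb
  have i2 : Integrable (fun p : X × X => k p.1 p.2 * v p.2 ^ 2) (μ.prod μ) :=
    (hv2.comp_snd μ).bdd_mul hkm hkb
  have i3 : Integrable (fun p : X × X => k p.1 p.2 * (v p.1 * v p.2)) (μ.prod μ) :=
    (hvi.mul_prod hvi).bdd_mul hkm hkb
  -- The two square terms have equal integrals by symmetry of `k`, whence the factor 2.
  have hexp : (fun p : X × X => k p.1 p.2 * (v p.1 - v p.2) ^ 2) = fun p =>
      (k p.1 p.2 * v p.1 ^ 2 + k p.1 p.2 * v p.2 ^ 2) - 2 * (k p.1 p.2 * (v p.1 * v p.2)) := by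
    funext p; ring
  rw [hexp]
  refine ⟨(i1.add i2).sub (i3.const_mul 2), ?_⟩
  have hswap : ∫ p : X × X, k p.1 p.2 * v p.2 ^ 2 ∂(μ.prod μ) =
      ∫ p : X × X, k p.1 p.2 * v p.1 ^ 2 ∂(μ.prod μ) := by
    rw [← integral_prod_swap]
    simp only [Prod.fst_swap, Prod.snd_swap]
    exact integral_congr_ae (ae_of_all _ fun p => by simp only [hsymm p.2 p.1])
  have i12 : Integrable (fun p : X × X => k p.1 p.2 * v p.1 ^ 2 + k p.1 p.2 * v p.2 ^ 2)
      (μ.prod μ) := i1.add i2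
  rw [integral_sub i12 (i3.const_mul 2), integral_add i1 i2, hswap, integral_const_mul,
    integral_prod _ i1, integral_prod _ i3, ← two_mul, ← mul_sub]
  rw [← integral_sub i1.integral_prod_left i3.integral_prod_left]
  congr 1
  refine integral_congr_ae (ae_of_all _ fun x => ?_)
  simp only
  have h : ∀ y, k x y * (v x * v y) = k x y * v y * v x := fun y => by ring
  simp_rw [h, integral_mul_const]
  ring

end KernelOperators

/-! ### Nonlocal Poincaré inequality -/

section Poincare

theorem ofReal_sub_sq_le (a b c : ℝ) : ENNReal.ofReal ((a - c) ^ 2) ≤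
    2 * ENNReal.ofReal ((a - b) ^ 2) + 2 * ENNReal.ofReal ((b - c) ^ 2) := by
  have h2 : (2 : ENNReal) = ENNReal.ofReal 2 := by simp
  rw [h2, ← ENNReal.ofReal_mul zero_le_two, ← ENNReal.ofReal_mul zero_le_two,
    ← ENNReal.ofReal_add (by positivity) (by positivity)]
  exact ENNReal.ofReal_le_ofReal (by nlinarith [sq_nonneg (a - b - (b - c))])

/-- Mean square differences over two pairs of measures chain through the common measure. -/
theorem lintegral_sub_sq_chain {X : Type*} [MeasurableSpace X] (α β γ : Measure X)
    [SFinite α] [SFinite β] [SFinite γ] {v : X → ℝ} (hv : Measurable v) :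
    β univ * ∫⁻ x, ∫⁻ z, ENNReal.ofReal ((v x - v z) ^ 2) ∂γ ∂α ≤
      2 * γ univ * ∫⁻ x, ∫⁻ y, ENNReal.ofReal ((v x - v y) ^ 2) ∂β ∂α +
      2 * α univ * ∫⁻ y, ∫⁻ z, ENNReal.ofReal ((v y - v z) ^ 2) ∂γ ∂β := by
  have hD : Measurable (Function.uncurry fun x y => ENNReal.ofReal ((v x - v y) ^ 2)) := by
    unfold Function.uncurry
    fun_prop
  have hDr : ∀ x, Measurable fun y => ENNReal.ofReal ((v x - v y) ^ 2) := fun x => by fun_prop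
  -- The pointwise inequality is averaged over the intermediate point `y`.
  have hpt : ∀ x z, β univ * ENNReal.ofReal ((v x - v z) ^ 2) ≤
      2 * (∫⁻ y, ENNReal.ofReal ((v x - v y) ^ 2) ∂β) +
      2 * ∫⁻ y, ENNReal.ofReal ((v y - v z) ^ 2) ∂β := by
    intro x z
    rw [← lintegral_const_mul _ (hDr x), ← lintegral_const_mul _ (by fun_prop),
      ← lintegral_add_left ((hDr x).const_mul 2), mul_comm, ← lintegral_const]
    exact lintegral_mono fun y => ofReal_sub_sq_le _ _ _
  have hx : ∀ x, β univ * ∫⁻ z, ENNReal.ofReal ((v x - v z) ^ 2) ∂γ ≤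
      2 * γ univ * (∫⁻ y, ENNReal.ofReal ((v x - v y) ^ 2) ∂β) +
      2 * ∫⁻ y, ∫⁻ z, ENNReal.ofReal ((v y - v z) ^ 2) ∂γ ∂β := by
    intro x
    rw [lintegral_lintegral_swap hD.aemeasurable, ← lintegral_const_mul _ (hDr x)]
    refine (lintegral_mono fun z => hpt x z).trans_eq ?_
    rw [lintegral_add_left measurable_const, lintegral_const, lintegral_const_mul]
    · ring
    · exact hD.lintegral_prod_left'
  have hDm : Measurable fun x => ∫⁻ z, ENNReal.ofReal ((v x - v z) ^ 2) ∂γ :=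
    hD.lintegral_prod_right'
  rw [← lintegral_const_mul _ hDm]
  refine (lintegral_mono hx).trans_eq ?_
  rw [lintegral_add_right _ measurable_const, lintegral_const, lintegral_const_mul]
  · ring
  · exact hD.lintegral_prod_right'

open Filter Topology in
/-- Nonlocal Poincaré inequality: on a connected bounded open set, the full double integral of
`(v x - v y)²` is controlled by its part near the diagonal. -/
theorem exists_lintegral_sub_sq_le {d : ℕ} {Ω : Set (Space d)} (hΩ : IsOpen Ω)
    (hconn : IsPreconnected Ω) (hbdd : Bornology.IsBounded Ω) {ρ : ℝ} (hρ : 0 < ρ) :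
    ∃ C : ENNReal, C ≠ ⊤ ∧ ∀ v : Space d → ℝ, Measurable v →
      ∫⁻ x in Ω, ∫⁻ y in Ω, ENNReal.ofReal ((v x - v y) ^ 2) ≤
        C * ∫⁻ p in {p : Space d × Space d | dist p.1 p.2 < ρ},
          ENNReal.ofReal ((v p.1 - v p.2) ^ 2)
            ∂((volume.restrict Ω).prod (volume.restrict Ω)) := by
  set μ := (volume : Measure (Space d)).restrict Ω with hμ
  -- With centres less than `σ` apart, points of the two balls are joined by three hops shorter than
  -- `ρ / 3`, hence are within `ρ`.
  set σ := ρ / 3 with hσ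
  have hσ0 : 0 < σ := by positivity
  have : IsFiniteMeasure μ := ⟨by
    rw [hμ, Measure.restrict_apply_univ]; exact hbdd.measure_lt_top⟩
  set E : (Space d → ℝ) → ENNReal := fun v =>
    ∫⁻ p in {p : Space d × Space d | dist p.1 p.2 < ρ},
      ENNReal.ofReal ((v p.1 - v p.2) ^ 2) ∂(μ.prod μ) with hE
  set m : Space d → Measure (Space d) := fun x => μ.restrict (Metric.ball x σ) with hm
  -- `P a b`: differences between the balls at `a` and `b` are controlled by the near-diagonal
  -- energy. The relation is local, symmetric and transitive, so connectedness spreads it to all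
  -- pairs in `Ω`; the constant may depend on the pair.
  set P : Space d → Space d → Prop := fun a b => ∃ C : ENNReal, C ≠ ⊤ ∧
    ∀ v : Space d → ℝ, Measurable v →
      ∫⁻ x, ∫⁻ y, ENNReal.ofReal ((v x - v y) ^ 2) ∂(m b) ∂(m a) ≤ C * E v with hP
  have hD : ∀ v : Space d → ℝ, Measurable v →
      Measurable (fun p : Space d × Space d => ENNReal.ofReal ((v p.1 - v p.2) ^ 2)) :=
    fun v hv => by fun_prop
  have hloc : ∀ a ∈ Ω, ∀ᶠ b in 𝓝[Ω] a, P a b := by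
    intro a _
    filter_upwards [mem_nhdsWithin_of_mem_nhds (Metric.ball_mem_nhds a hσ0)] with b hb
    refine ⟨1, ENNReal.one_ne_top, fun v hv => ?_⟩
    rw [one_mul, ← lintegral_prod _ (hD v hv).aemeasurable, hm]
    simp only
    rw [Measure.prod_restrict]
    refine lintegral_mono_set fun p hp => ?_
    have h1 : dist p.1 a < σ := hp.1
    have h2 : dist p.2 b < σ := hp.2
    have h3 : dist b a < σ := hb
    have h4 := dist_triangle p.1 a p.2
    have h5 := dist_triangle a b p.2
    rw [dist_comm a b, dist_comm b p.2] at h5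
    change dist p.1 p.2 < ρ
    rw [hσ] at h1 h2 h3
    linarith
  have htrans : ∀ a b c, a ∈ Ω → b ∈ Ω → c ∈ Ω → P a b → P b c → P a c := by
    rintro a b c - hb - ⟨C₁, hC₁, h₁⟩ ⟨C₂, hC₂, h₂⟩
    -- Chaining through the ball at `b` divides by its mass in `Ω`, which is positive as `b` lies in
    -- the open set `Ω`.
    have hpos : m b univ ≠ 0 := by
      rw [hm, hμ]
      simp only
      rw [Measure.restrict_apply_univ, Measure.restrict_apply Metric.isOpen_ball.measurableSet]
      exact ((Metric.isOpen_ball.inter hΩ).measure_pos _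
        ⟨b, Metric.mem_ball_self hσ0, hb⟩).ne'
    refine ⟨(m b univ)⁻¹ * (2 * m c univ * C₁ + 2 * m a univ * C₂), ?_, fun v hv => ?_⟩
    · refine ENNReal.mul_ne_top (ENNReal.inv_ne_top.2 hpos) (ENNReal.add_ne_top.2 ⟨?_, ?_⟩)
      · exact ENNReal.mul_ne_top (ENNReal.mul_ne_top (by simp) (measure_ne_top _ _)) hC₁
      · exact ENNReal.mul_ne_top (ENNReal.mul_ne_top (by simp) (measure_ne_top _ _)) hC₂
    · rw [mul_assoc, ← ENNReal.mul_le_iff_le_inv hpos (measure_ne_top _ _)]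
      refine (lintegral_sub_sq_chain (m a) (m b) (m c) hv).trans ?_
      rw [add_mul, mul_assoc (2 * m c univ), mul_assoc (2 * m a univ)]
      gcongr
      · exact h₁ v hv
      · exact h₂ v hv
  have hsymm : ∀ a b, a ∈ Ω → b ∈ Ω → P a b → P b a := by
    rintro a b - - ⟨C, hC, h⟩
    refine ⟨C, hC, fun v hv => ?_⟩
    rw [lintegral_lintegral_swap (hD v hv).aemeasurable]
    refine le_trans (le_of_eq ?_) (h v hv)
    simp_rw [sub_sq_comm]
  have hall : ∀ a b, ∃ C : ENNReal, C ≠ ⊤ ∧ (a ∈ Ω → b ∈ Ω → ∀ v : Space d → ℝ, Measurable v →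
      ∫⁻ x, ∫⁻ y, ENNReal.ofReal ((v x - v y) ^ 2) ∂(m b) ∂(m a) ≤ C * E v) := by
    intro a b
    by_cases hab : a ∈ Ω ∧ b ∈ Ω
    · obtain ⟨C, hC, h⟩ : P a b := hconn.induction₂ P hloc htrans hsymm hab.1 hab.2
      exact ⟨C, hC, fun _ _ => h⟩
    · exact ⟨0, ENNReal.zero_ne_top, fun ha hb => absurd ⟨ha, hb⟩ hab⟩
  choose C hC hCE using hall
  -- Finitely many balls centred in `Ω` cover it, so finitely many of the pairwise constants
  -- suffice.
  obtain ⟨t', htΩ, htfin, hcov⟩ := Metric.finite_approx_of_totallyBounded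
    (hbdd.isCompact_closure.totallyBounded.subset subset_closure) σ hσ0
  lift t' to Finset (Space d) using htfin with t
  have hle : μ ≤ ∑ a ∈ t, m a := by
    refine Measure.le_iff.2 fun s hs => ?_
    rw [Measure.finsetSum_apply]
    have hsub : s ∩ Ω ⊆ ⋃ a ∈ t, (s ∩ Metric.ball a σ) ∩ Ω := by
      rintro x ⟨hxs, hxΩ⟩
      obtain ⟨a, ha, hxa⟩ := mem_iUnion₂.1 (hcov hxΩ)
      exact mem_iUnion₂.2 ⟨a, ha, ⟨hxs, hxa⟩, hxΩ⟩
    rw [hμ, Measure.restrict_apply hs]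
    refine (measure_mono hsub).trans ((measure_biUnion_finset_le _ _).trans_eq ?_)
    refine Finset.sum_congr rfl fun a _ => ?_
    rw [hm]
    simp only
    rw [Measure.restrict_apply hs, hμ,
      Measure.restrict_apply (hs.inter Metric.isOpen_ball.measurableSet)]
  refine ⟨∑ a ∈ t, ∑ b ∈ t, C a b, ?_, fun v hv => ?_⟩
  · exact ENNReal.sum_ne_top.2 fun a _ => ENNReal.sum_ne_top.2 fun b _ => hC a b
  calc ∫⁻ x, ∫⁻ y, ENNReal.ofReal ((v x - v y) ^ 2) ∂μ ∂μ
      ≤ ∫⁻ x, ∫⁻ y, ENNReal.ofReal ((v x - v y) ^ 2) ∂(∑ b ∈ t, m b) ∂(∑ a ∈ t, m a) :=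
        lintegral_mono' hle fun x => lintegral_mono' hle le_rfl
    _ = ∑ a ∈ t, ∑ b ∈ t, ∫⁻ x, ∫⁻ y, ENNReal.ofReal ((v x - v y) ^ 2) ∂(m b) ∂(m a) := by
        rw [lintegral_finsetSum_measure]
        refine Finset.sum_congr rfl fun a _ => ?_
        simp_rw [lintegral_finsetSum_measure]
        exact lintegral_finsetSum _ fun b _ => (hD v hv).lintegral_prod_right'
    _ ≤ ∑ a ∈ t, ∑ b ∈ t, C a b * E v :=
        Finset.sum_le_sum fun a ha => Finset.sum_le_sum fun b hb =>
          hCE a b (htΩ ha) (htΩ hb) v hv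
    _ = (∑ a ∈ t, ∑ b ∈ t, C a b) * E v := by simp_rw [Finset.sum_mul]

end Poincare

/-! ### Properties of the scaled kernels -/

section Scaled

variable {d : ℕ} {δ : ℝ}

theorem scaled_comm (k : ℝ → ℝ) (x y : Space d) : scaled k δ x y = scaled k δ y x := by
  rw [scaled, scaled, norm_sub_rev]

theorem scaled_nonneg {k : ℝ → ℝ} (hk : ∀ s, 0 ≤ s → 0 ≤ k s) (hδ : 0 < δ) (x y : Space d) :
    0 ≤ scaled k δ x y :=
  mul_nonneg (by positivity) (hk _ (by positivity))

theorem isBoundedKernel_scaled {k : ℝ → ℝ} (hk : AntitoneOn k (Ici 0)) (h0 : ∀ s, 0 ≤ s → 0 ≤ k s)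
    (hδ : 0 < δ) :
    IsBoundedKernel (scaled (d := d) k δ) (1 / δ ^ d * k 0) := by
  constructor
  · have hanti : Antitone fun s => k (max s 0) := fun s t hst =>
      hk (mem_Ici.2 (le_max_right _ _)) (mem_Ici.2 (le_max_right _ _)) (max_le_max_right 0 hst)
    have heq : Function.uncurry (scaled (d := d) k δ) = fun p : Space d × Space d =>
        1 / δ ^ d * (fun s => k (max s 0)) (‖p.1 - p.2‖ ^ 2 / (4 * δ ^ 2)) := by
      funext p
      simp only [Function.uncurry, scaled]
      rw [max_eq_left (by positivity)]
    rw [heq]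
    exact (hanti.measurable.comp (by fun_prop)).const_mul _
  · intro x y
    rw [abs_of_nonneg (scaled_nonneg h0 hδ x y), scaled]
    have hs : 0 ≤ ‖x - y‖ ^ 2 / (4 * δ ^ 2) := by positivity
    exact mul_le_mul_of_nonneg_left (hk (mem_Ici.2 le_rfl) (mem_Ici.2 hs) hs) (by positivity)

/-- A nonzero, nonnegative decreasing kernel has `k 0 > 0`, and by continuity stays above `k 0 / 2`
near `0`. -/
theorem IsKernel.exists_le_scaled {ρ : ℝ} {k : ℝ → ℝ} (hk : IsKernel ρ k)
    (hne : ∃ s, 0 ≤ s ∧ k s ≠ 0) (hδ : 0 < δ) :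
    ∃ r c : ℝ, 0 < r ∧ 0 < c ∧ ∀ x y : Space d, dist x y < r → c ≤ scaled k δ x y := by
  obtain ⟨s, hs0, hs⟩ := hne
  have hk0 : 0 < k 0 := ((hk.nonneg s hs0).lt_of_ne' hs).trans_le
    (hk.antitoneOn (mem_Ici.2 le_rfl) (mem_Ici.2 hs0) hs0)
  have hcont := hk.contDiffOn.continuousOn 0 (mem_Ici.2 le_rfl)
  have hev := hcont.eventually (lt_mem_nhds (half_lt_self hk0))
  obtain ⟨η, hη, hηk⟩ := Metric.mem_nhdsWithin_iff.1 hev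
  refine ⟨2 * δ * √η, 1 / δ ^ d * (k 0 / 2), by positivity, by positivity, fun x y hxy => ?_⟩
  refine mul_le_mul_of_nonneg_left (le_of_lt (hηk ⟨?_, ?_⟩)) (by positivity)
  · rw [Metric.mem_ball, Real.dist_0_eq_abs, abs_of_nonneg (by positivity),
      div_lt_iff₀ (by positivity)]
    rw [dist_eq_norm] at hxy
    calc ‖x - y‖ ^ 2 < (2 * δ * √η) ^ 2 := by gcongr
      _ = η * (4 * δ ^ 2) := by rw [mul_pow, Real.sq_sqrt hη.le]; ring
  · exact mem_Ici.2 (by positivity)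

theorem IsKernel.integrableOn_Ioi {ρ : ℝ} {k : ℝ → ℝ} (hk : IsKernel ρ k) {x : ℝ} (hx : 0 ≤ x) :
    IntegrableOn k (Ioi x) := by
  have h1 : IntegrableOn k (Icc 0 (ρ ^ 2 / 4)) :=
    (hk.contDiffOn.continuousOn.mono Icc_subset_Ici_self).integrableOn_Icc
  have h2 : IntegrableOn k (Ioi (ρ ^ 2 / 4)) := by
    refine integrableOn_zero.congr_fun (fun s hs => ?_) measurableSet_Ioi
    by_contra hne
    have hs' : ρ ^ 2 / 4 < s := hs
    have := hk.support s (by nlinarith [sq_nonneg ρ]) (Ne.symm hne)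
    linarith
  refine (h1.union h2).mono_set fun s hs => ?_
  rcases le_or_gt s (ρ ^ 2 / 4) with h | h
  · exact Or.inl ⟨hx.trans (le_of_lt hs), h⟩
  · exact Or.inr h

theorem IsKernel.tail_nonneg {ρ : ℝ} {k : ℝ → ℝ} (hk : IsKernel ρ k) (x : ℝ) (hx : 0 ≤ x) :
    0 ≤ tail k x :=
  setIntegral_nonneg measurableSet_Ioi fun s hs => hk.nonneg s (hx.trans (le_of_lt hs))

theorem IsKernel.tail_antitoneOn {ρ : ℝ} {k : ℝ → ℝ} (hk : IsKernel ρ k) :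
    AntitoneOn (tail k) (Ici 0) := by
  intro x hx y _ hxy
  refine setIntegral_mono_set (hk.integrableOn_Ioi hx) ?_
    (Ioi_subset_Ioi hxy).eventuallyLE
  filter_upwards [ae_restrict_mem measurableSet_Ioi] with s hs
  exact hk.nonneg s ((mem_Ici.1 hx).trans (le_of_lt hs))

end Scaled

/-! ### Coercivity and positivity of kernels on the domain -/

/-- A nonnegative symmetric kernel that is bounded below near the diagonal has a Dirichlet form
that is coercive on functions of mean zero. -/
theorem IsBoundedKernel.exists_coercive {d : ℕ} {Ω : Set (Space d)} (hΩ : IsOpen Ω)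
    (hconn : IsConnected Ω) (hbdd : Bornology.IsBounded Ω) {k : Space d → Space d → ℝ} {M r c : ℝ}
    (hk : IsBoundedKernel k M) (hsymm : ∀ x y, k x y = k y x) (hnn : ∀ x y, 0 ≤ k x y)
    (hr : 0 < r) (hc : 0 < c) (hlow : ∀ x y, dist x y < r → c ≤ k x y) :
    ∃ κ, 0 < κ ∧ ∀ v : L2 Ω, ∫ x in Ω, v x = 0 → κ * ‖v‖ ^ 2 ≤
      ∫ x in Ω, ((∫ y in Ω, k x y) * v x - ∫ y in Ω, k x y * v y) * v x := by
  obtain ⟨C, hC, hP⟩ := exists_lintegral_sub_sq_le hΩ hconn.isPreconnected hbdd hr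
  set μ := (volume : Measure (Space d)).restrict Ω with hμ
  have hfin : IsFiniteMeasure μ := ⟨by
    rw [hμ, Measure.restrict_apply_univ]; exact hbdd.measure_lt_top⟩
  have hm : 0 < μ.real univ := by
    rw [Measure.real, ENNReal.toReal_pos_iff, hμ, Measure.restrict_apply_univ]
    exact ⟨hΩ.measure_pos _ hconn.nonempty, hbdd.measure_lt_top⟩
  -- The Poincaré inequality will give `|Ω| ‖v‖² ≤ C c⁻¹ I`, with `I` the form on the right; the `+
  -- 1` keeps the denominator positive if `C = 0`.
  refine ⟨μ.real univ / (C.toReal * c⁻¹ + 1), by positivity, fun v hv0 => ?_⟩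
  obtain ⟨i1, e1⟩ := IsBoundedKernel.integral_prod_mul_sub_sq (k := fun _ _ : Space d => (1 : ℝ))
    (M := 1) ⟨measurable_const, fun _ _ => by simp⟩ (fun _ _ => rfl) (Lp.memLp v)
  obtain ⟨i2, e2⟩ := hk.integral_prod_mul_sub_sq hsymm (Lp.memLp v)
  have hnorm : ‖v‖ ^ 2 = ∫ x, v x * v x ∂μ := by
    rw [← real_inner_self_eq_norm_sq, L2.inner_def]
    rfl
  -- For the kernel `1` the cross term is the square of the mean, which vanishes.
  have e1' : ∫ p : Space d × Space d, 1 * (v p.1 - v p.2) ^ 2 ∂(μ.prod μ) =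
      2 * (μ.real univ * ‖v‖ ^ 2) := by
    rw [e1, hnorm, ← integral_const_mul (μ.real univ)]
    simp_rw [one_mul]
    rw [hv0]
    simp [mul_assoc, hμ]
  set I := ∫ x, ((∫ y, k x y ∂μ) * v x - ∫ y, k x y * v y ∂μ) * v x ∂μ with hI
  have hI0 : 0 ≤ I := by
    have : 0 ≤ ∫ p : Space d × Space d, k p.1 p.2 * (v p.1 - v p.2) ^ 2 ∂(μ.prod μ) :=
      integral_nonneg fun p => mul_nonneg (hnn _ _) (sq_nonneg _)
    rw [e2] at this
    linarith
  have hvm : Measurable v := (Lp.stronglyMeasurable v).measurable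
  have hkey : ENNReal.ofReal (2 * (μ.real univ * ‖v‖ ^ 2)) ≤
      ENNReal.ofReal (C.toReal * c⁻¹ * (2 * I)) := by
    have hset : MeasurableSet {p : Space d × Space d | dist p.1 p.2 < r} :=
      measurableSet_lt (by fun_prop) measurable_const
    calc ENNReal.ofReal (2 * (μ.real univ * ‖v‖ ^ 2))
        = ∫⁻ p : Space d × Space d, ENNReal.ofReal (1 * (v p.1 - v p.2) ^ 2) ∂(μ.prod μ) := by
          rw [← e1', ofReal_integral_eq_lintegral_ofReal i1 (ae_of_all _ fun p => by positivity)]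
      _ = ∫⁻ x, ∫⁻ y, ENNReal.ofReal ((v x - v y) ^ 2) ∂μ ∂μ := by
          simp_rw [one_mul]
          exact lintegral_prod _ (by fun_prop)
      _ ≤ C * ∫⁻ p in {p : Space d × Space d | dist p.1 p.2 < r},
            ENNReal.ofReal ((v p.1 - v p.2) ^ 2) ∂(μ.prod μ) := hP v hvm
      _ ≤ C * ∫⁻ p in {p : Space d × Space d | dist p.1 p.2 < r},
            ENNReal.ofReal (c⁻¹ * (k p.1 p.2 * (v p.1 - v p.2) ^ 2)) ∂(μ.prod μ) := by
          refine mul_le_mul_right ?_ C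
          refine setLIntegral_mono' hset fun p hp => ENNReal.ofReal_le_ofReal ?_
          rw [← mul_assoc]
          refine le_mul_of_one_le_left (sq_nonneg _) ?_
          rw [inv_mul_eq_div, one_le_div hc]
          exact hlow _ _ hp
      _ ≤ C * ∫⁻ p, ENNReal.ofReal (c⁻¹ * (k p.1 p.2 * (v p.1 - v p.2) ^ 2)) ∂(μ.prod μ) := by
          gcongr
          exact Measure.restrict_le_self
      _ = ENNReal.ofReal C.toReal * ENNReal.ofReal (c⁻¹ * (2 * I)) := by
          rw [← ofReal_integral_eq_lintegral_ofReal (i2.const_mul _) (ae_of_all _ fun p =>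
            mul_nonneg (by positivity) (mul_nonneg (hnn _ _) (sq_nonneg _))), integral_const_mul,
            e2, ENNReal.ofReal_toReal hC]
      _ = ENNReal.ofReal (C.toReal * c⁻¹ * (2 * I)) := by
          rw [← ENNReal.ofReal_mul ENNReal.toReal_nonneg, mul_assoc]
  rw [ENNReal.ofReal_le_ofReal_iff (by positivity)] at hkey
  rw [div_mul_eq_mul_div, div_le_iff₀ (by positivity)]
  linarith

/-- Each ball about a point of the closure meets `Ω` in a nonempty open set, so boundary points are
covered too. -/
theorem IsBoundedKernel.setIntegral_pos {d : ℕ} {Ω : Set (Space d)} (hΩ : IsOpen Ω)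
    (hbdd : Bornology.IsBounded Ω) {k : Space d → Space d → ℝ} {M r c : ℝ}
    (hk : IsBoundedKernel k M) (hnn : ∀ x y, 0 ≤ k x y)
    (hr : 0 < r) (hc : 0 < c) (hlow : ∀ x y, dist x y < r → c ≤ k x y) {x : Space d}
    (hx : x ∈ closure Ω) : 0 < ∫ y in Ω, k x y := by
  have hfin : IsFiniteMeasure ((volume : Measure (Space d)).restrict Ω) := ⟨by
    rw [Measure.restrict_apply_univ]; exact hbdd.measure_lt_top⟩
  rw [integral_pos_iff_support_of_nonneg (hnn x) (hk.integrable x)]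
  have hsub : Metric.ball x r ⊆ Function.support (k x) := fun y hy =>
    (hc.trans_le (hlow x y (by rwa [dist_comm]))).ne'
  refine lt_of_lt_of_le ?_ (measure_mono hsub)
  rw [Measure.restrict_apply Metric.isOpen_ball.measurableSet]
  exact (Metric.isOpen_ball.inter hΩ).measure_pos _
    (mem_closure_iff.1 hx _ Metric.isOpen_ball (Metric.mem_ball_self hr))

theorem integral_abs_sq_eq_norm_sq {X : Type*} [MeasurableSpace X] {μ : Measure X} (u : Lp ℝ 2 μ)
    {g : X → ℝ} (h : u =ᵐ[μ] g) :
    Integrable (fun x => |g x| ^ 2) μ ∧ ∫ x, |g x| ^ 2 ∂μ = ‖u‖ ^ 2 := by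
  have hae : (fun x => |g x| ^ 2) =ᵐ[μ] fun x => u x * u x := by
    filter_upwards [h] with x hx
    rw [sq_abs, hx, sq]
  refine ⟨(L2.integrable_inner (𝕜 := ℝ) u u).congr hae.symm, ?_⟩
  rw [integral_congr_ae hae, ← real_inner_self_eq_norm_sq, L2.inner_def]
  rfl

end NonlocalBiharmonic

/-! ### Assembly of the main theorem -/

set_option maxHeartbeats 1000000 in
open NonlocalBiharmonic in
theorem mainTheorem1 {d : ℕ} (hd : 1 ≤ d) (Ω : Set (Space d)) (hΩ : IsBoundedLipschitzDomain Ω)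
    (rK rR : ℝ) (hrK : 0 < rK) (hrR : 0 < rR) (K R : ℝ → ℝ)
    (hK : IsKernel rK K) (hR : IsKernel rR R)
    (hK0 : ∃ s, 0 ≤ s ∧ K s ≠ 0) (hR0 : ∃ s, 0 ≤ s ∧ R s ≠ 0)
    (f : L2 Ω) (a b : L2Boundary Ω) (δ ξ : ℝ) (hδ : 0 < δ) (hξ : 0 < ξ) :
    (∀ u : L2 Ω, EnergyWellDefined Ω K R δ a b f u) ∧
      ∃! u : L2 Ω, ∀ v : L2 Ω, energy Ω K R δ ξ a b f u ≤ energy Ω K R δ ξ a b f v := by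
  have hσfin := hΩ.isFiniteMeasure_surfaceMeasure
  have hσ0 := hΩ.surfaceMeasure_ne_zero hd
  have hμfin : IsFiniteMeasure ((volume : Measure (Space d)).restrict Ω) := ⟨by
    rw [Measure.restrict_apply_univ]; exact hΩ.isBounded.measure_lt_top⟩
  have kR := isBoundedKernel_scaled (d := d) hR.antitoneOn hR.nonneg hδ
  have kK := isBoundedKernel_scaled (d := d) hK.antitoneOn hK.nonneg hδ
  have kT := isBoundedKernel_scaled (d := d) hR.tail_antitoneOn hR.tail_nonneg hδ
  obtain ⟨TR, hTR⟩ := kR.exists_integralOp (μ := volume.restrict Ω) (ν := volume.restrict Ω)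
  obtain ⟨TK, hTK⟩ := kK.exists_integralOp (μ := surfaceMeasure Ω) (ν := volume.restrict Ω)
  obtain ⟨TB, hTB⟩ := kT.exists_integralOp (μ := volume.restrict Ω) (ν := surfaceMeasure Ω)
  obtain ⟨MR, hMR⟩ := exists_mulOp (μ := volume.restrict Ω)
    (kR.stronglyMeasurable_integral (ν := volume.restrict Ω)).aestronglyMeasurable
    kR.abs_integral_le
  obtain ⟨MK, hMK⟩ := exists_mulOp (μ := surfaceMeasure Ω)
    (kK.stronglyMeasurable_integral (ν := volume.restrict Ω)).aestronglyMeasurable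
    kK.abs_integral_le
  set A : L2 Ω →L[ℝ] L2 Ω := (1 / δ ^ 2) • (MR - TR) with hA
  have hAcoe : ∀ u, A u =ᵐ[volume.restrict Ω] fun x =>
      1 / δ ^ 2 * ((∫ y in Ω, scaled R δ x y) * u x - ∫ y in Ω, scaled R δ x y * u y) := by
    intro u
    filter_upwards [Lp.coeFn_smul (1 / δ ^ 2) (MR u - TR u), Lp.coeFn_sub (MR u) (TR u), hMR u,
      hTR u] with x h1 h2 h3 h4
    rw [show A u = (1 / δ ^ 2) • (MR u - TR u) from rfl, h1, Pi.smul_apply, h2, Pi.sub_apply, h3,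
      h4, smul_eq_mul]
  have hint : ∀ u, (A u - (2 : ℝ) • TB b : L2 Ω) =ᵐ[volume.restrict Ω]
      interiorTerm Ω R δ b u := by
    intro u
    filter_upwards [Lp.coeFn_sub (A u) ((2 : ℝ) • TB b), Lp.coeFn_smul (2 : ℝ) (TB b), hAcoe u,
      hTB b] with x h1 h2 h3 h4
    rw [h1, Pi.sub_apply, h2, Pi.smul_apply, h3, h4, smul_eq_mul, interiorTerm,
      (kR.integral_mul_sub (Lp_two_integrable u) (u x) x).2]
  have hres : ∀ u, (MK a - TK u : L2Boundary Ω) =ᵐ[surfaceMeasure Ω]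
      boundaryResidual Ω K δ a u := by
    intro u
    filter_upwards [Lp.coeFn_sub (MK a) (TK u), hMK a, hTK u] with x h1 h2 h3
    rw [h1, Pi.sub_apply, h2, h3, boundaryResidual,
      (kK.integral_mul_sub (Lp_two_integrable u) (a x) x).2]
  have hsource : ∀ u : L2 Ω, IntegrableOn (fun x => f x * u x) Ω := fun u =>
    MemLp.integrable_mul (Lp.memLp f) (Lp.memLp u)
  refine ⟨fun u => ?_, ?_⟩
  · exact
      { tail_integrable := fun x hx => hR.integrableOn_Ioi hx
        laplacian_integrable := ae_of_all _ fun x =>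
          (kR.integral_mul_sub (Lp_two_integrable u) (u x) x).1
        flux_integrable := ae_of_all _ fun x => kT.integrable_mul (Lp_two_integrable b) x
        interior_integrable := (integral_abs_sq_eq_norm_sq _ (hint u)).1
        source_integrable := hsource u
        residual_integrable := ae_of_all _ fun x =>
          (kK.integral_mul_sub (Lp_two_integrable u) (a x) x).1
        penalty_integrable := (integral_abs_sq_eq_norm_sq _ (hres u)).1 }
  obtain ⟨ρR, cR, hρR, hcR, hlowR⟩ := hR.exists_le_scaled (d := d) hR0 hδ
  obtain ⟨ρK, cK, hρK, hcK, hlowK⟩ := hK.exists_le_scaled (d := d) hK0 hδ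
  obtain ⟨κ, hκ, hcoer⟩ := kR.exists_coercive hΩ.isOpen hΩ.isConnected hΩ.isBounded
    (scaled_comm R) (scaled_nonneg hR.nonneg hδ) hρR hcR hlowR
  -- Scaling by `s` absorbs the factor `1 / ξ` of the penalty into a squared norm.
  set s := √(1 / ξ) with hs
  have hs0 : 0 < s := by positivity
  have hone : MemLp (fun _ : Space d => (1 : ℝ)) 2 (volume.restrict Ω) := memLp_const 1
  set e : L2 Ω := hone.toLp _ with he
  have hecoe : e =ᵐ[volume.restrict Ω] fun _ => (1 : ℝ) := hone.coeFn_toLp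
  have hinte : ∀ x : Space d, ∀ k : Space d → Space d → ℝ,
      ∫ y in Ω, k x y * e y = ∫ y in Ω, k x y := fun x k => by
    refine integral_congr_ae ?_
    filter_upwards [hecoe] with y hy
    rw [hy, mul_one]
  have hAe : A e = 0 := by
    apply Lp.ext
    filter_upwards [hAcoe e, hecoe, Lp.coeFn_zero ℝ 2 (volume.restrict Ω)] with x h1 h2 h3
    rw [h1, h3, h2, hinte, mul_one, sub_self, mul_zero, Pi.zero_apply]
  -- `TK e` is strictly positive on `∂Ω`; were it zero almost everywhere, the surface measure would
  -- vanish.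
  have hTKe : TK e ≠ 0 := by
    intro h0
    refine hσ0 (ae_eq_bot.1 (Filter.eventually_false_iff_eq_bot.1 ?_))
    have h1 := hTK e
    rw [h0] at h1
    filter_upwards [h1, Lp.coeFn_zero ℝ 2 (surfaceMeasure Ω),
      ae_restrict_mem isClosed_frontier.measurableSet] with x h2 h3 h4
    rw [h3, hinte] at h2
    exact (kK.setIntegral_pos hΩ.isOpen hΩ.isBounded (scaled_nonneg hK.nonneg hδ) hρK hcK hlowK
      (frontier_subset_closure h4)).ne h2
  have hcoerA : ∀ v, inner ℝ e v = 0 → 1 / δ ^ 2 * κ * ‖v‖ ^ 2 ≤ inner ℝ (A v) v := by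
    intro v hv
    have hv0 : ∫ x in Ω, v x = 0 := by
      rw [← hv, L2.inner_def]
      refine integral_congr_ae ?_
      filter_upwards [hecoe] with x hx
      rw [hx]
      simp
    have hin : inner ℝ (A v) v = 1 / δ ^ 2 * ∫ x in Ω,
        ((∫ y in Ω, scaled R δ x y) * v x - ∫ y in Ω, scaled R δ x y * v y) * v x := by
      rw [L2.inner_def, ← integral_const_mul]
      refine integral_congr_ae ?_
      filter_upwards [hAcoe v] with x hx
      rw [hx, ← mul_assoc]
      exact mul_comm _ _
    rw [hin, mul_assoc]
    exact mul_le_mul_of_nonneg_left (hcoer v hv0) (by positivity)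
  obtain ⟨c, hc, hle⟩ := exists_sq_norm_le_of_coercive_orthogonal A (s • TK) (e := e)
    (c := 1 / δ ^ 2 * κ) (by positivity) hAe (smul_ne_zero hs0.ne' hTKe) hcoerA
  refine existsUnique_forall_le_of_coercive A (s • TK) hc hle ((2 : ℝ) • TB b) f (s • MK a) _
    fun u => ?_
  have h1 : (s • TK) u - s • MK a = -(s • (MK a - TK u)) := by
    rw [smul_apply, smul_sub, neg_sub]
  have h2 : inner ℝ f u = ∫ x in Ω, f x * u x := by
    rw [L2.inner_def]
    refine integral_congr_ae (ae_of_all _ fun x => ?_)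
    simp [mul_comm]
  rw [h1, norm_neg, norm_smul, mul_pow, Real.norm_eq_abs, sq_abs, hs, Real.sq_sqrt (by positivity),
    h2, energy, penalty, (integral_abs_sq_eq_norm_sq _ (hint u)).2,
    (integral_abs_sq_eq_norm_sq _ (hres u)).2]
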